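/- Let $\mathbf{C}$ be the space of continuous functions $x:[0,1]\to\mathbb{R}$ with $x(0)=0$, with the supremum norm and its Borel $\sigma$-field $\mathfrak{C}$, and let $t_1,t_2,\ldots$ be a sequence of points of $[0,1]$ whose set of values is dense in $[0,1]$. For $n\ge 1$ let $\pi_n:\mathbf{C}\to\mathbb{R}^n$, $\pi_n(x)=(x(t_1),\ldots,x(t_n))$, let $\nu_n$ be the $n$-variate normal distribution on $\mathbb{R}^n$ with zero means and covariances $\min\{t_j,t_r\}$, and let $\alpha_n$ be the measure on the $\sigma$-field of the sets $\pi_n^{-1}(S)$, $S\subset\mathbb{R}^n$ Borel, given by $\alpha_n(\pi_n^{-1}(S))=\nu_n(S)$. For compact $K\subset\mathbf{C}$ put $$\varphi(K)=\lim_{n\to\infty}\alpha_n\bigl(\pi_n^{-1}(\pi_n(K))\bigr)$$ (the limit of a decreasing sequence), and for $A\in\mathfrak{C}$ put $$\mu(A)=\sup\{\varphi(K): K\subset A,\ K\text{ compact}\}.$$ Then, for all $A,B\in\mathfrak{C}$ with $A\cap B=\emptyset$, $$\mu(A\cup B)=\mu(A)+\mu(B).$$ -/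

import Mathlib

open MeasureTheory ProbabilityTheory Filter Topology
open scoped ENNReal unitInterval

/-- The space `C` of continuous functions `x : [0, 1] → ℝ` with `x 0 = 0`. Its topology is the one
it inherits from `C(I, ℝ)`, i.e. that of the uniform distance `sup |x t - y t|`. -/
abbrev PathSpace : Type := {x : C(I, ℝ) // x 0 = 0}

/-- The Borel `σ`-field of `C`, generated by the open sets. -/
abbrev pathBorel : MeasurableSpace PathSpace := borel PathSpace

/-- The projection `x ↦ (x (s 1), …, x (s k))` of `C` to `ℝ^k`. -/
def pathProj {k : ℕ} (s : Fin k → I) (x : PathSpace) : EuclideanSpace ℝ (Fin k) :=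
  WithLp.toLp 2 fun j => x.1 (s j)

/-- The matrix with entries `min (s j) (s r)`. -/
def minMatrix {k : ℕ} (s : Fin k → I) : Matrix (Fin k) (Fin k) ℝ :=
  Matrix.of fun j r => min (s j : ℝ) (s r : ℝ)

/-- The `k`-variate normal distribution with zero means and covariances `min (s j) (s r)`. -/
noncomputable def gaussMarginal {k : ℕ} (s : Fin k → I) : Measure (EuclideanSpace ℝ (Fin k)) :=
  multivariateGaussian 0 (minMatrix s)

/-- The measure carried back to the sets `pathProj s ⁻¹' S` with `S` Borel in `ℝ^k`: such a set `E`
gets the mass that `gaussMarginal s` gives to its projection (see `cylMeasure_preimage`). -/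
noncomputable def cylMeasure {k : ℕ} (s : Fin k → I) (E : Set PathSpace) : ℝ≥0∞ :=
  gaussMarginal s (pathProj s '' E)

/-- The initial segment `t 0, …, t (n - 1)` of a sequence of times. -/
def initSeg (t : ℕ → I) (n : ℕ) : Fin n → I := fun j => t j

/-- The set function `φ` on compact sets: the limit of the masses of the cylinders over the
projections of `K` (the limit exists, see `tendsto_compactContent`). -/
noncomputable def compactContent (t : ℕ → I) (K : Set PathSpace) : ℝ≥0∞ :=
  limUnder atTop fun n : ℕ =>
    cylMeasure (initSeg t n) (pathProj (initSeg t n) ⁻¹' (pathProj (initSeg t n) '' K))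

/-- The set function `μ`: the supremum of `φ K` over the compact sets `K ⊆ A`. -/
noncomputable def innerContent (t : ℕ → I) (A : Set PathSpace) : ℝ≥0∞ :=
  ⨆ (K : Set PathSpace) (_ : K ⊆ A) (_ : IsCompact K), compactContent t K

/-! Well-definedness of the above. -/

theorem posSemidef_minMatrix {k : ℕ} (s : Fin k → I) : (minMatrix s).PosSemidef := by
  have : minMatrix s =
      .of fun i j => volume.real ((Set.Icc (0 : ℝ) (s i)) ∩ (Set.Icc (0 : ℝ) (s j))) := by
    ext i j
    have h1 : 0 ≤ (s i : ℝ) := (s i).2.1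
    have h2 : 0 ≤ (s j : ℝ) := (s j).2.1
    simp [minMatrix, Set.Icc_inter_Icc, h1, h2]
  rw [this]
  exact posSemidef_matrix_measure_inter (fun _ => measurableSet_Icc)
    (fun _ => isCompact_Icc.measure_ne_top)

theorem continuous_pathProj {k : ℕ} (s : Fin k → I) : Continuous (pathProj s) := by
  unfold pathProj
  refine (PiLp.continuous_toLp 2 _).comp (continuous_pi fun j => ?_)
  exact (continuous_eval_const (s j)).comp continuous_subtype_val

/-- For distinct times in `(0, 1]` the projection is onto. -/
theorem surjective_pathProj {k : ℕ} {s : Fin k → I} (hs : Function.Injective s)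
    (h0 : ∀ j, s j ≠ 0) : Function.Surjective (pathProj s) := by
  intro v
  let p : Polynomial ℝ := Polynomial.X *
    Lagrange.interpolate Finset.univ (fun j => (s j : ℝ)) (fun j => v j / (s j : ℝ))
  refine ⟨⟨⟨fun u => p.eval (u : ℝ), by fun_prop⟩, by simp [p]⟩, ?_⟩
  ext j
  have hj : (s j : ℝ) ≠ 0 := fun h => h0 j (Subtype.ext h)
  have := Lagrange.eval_interpolate_at_node (s := Finset.univ) (v := fun j => (s j : ℝ))
    (fun j => v j / (s j : ℝ)) (fun a _ b _ hab => hs (Subtype.ext hab)) (Finset.mem_univ j)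
  simp only [pathProj, p, ContinuousMap.coe_mk, Polynomial.eval_mul, Polynomial.eval_X, this]
  field_simp

theorem cylMeasure_preimage {k : ℕ} {s : Fin k → I} (hs : Function.Injective s)
    (h0 : ∀ j, s j ≠ 0) (S : Set (EuclideanSpace ℝ (Fin k))) :
    cylMeasure s (pathProj s ⁻¹' S) = gaussMarginal s S := by
  rw [cylMeasure, Set.image_preimage_eq _ (surjective_pathProj hs h0)]

/-- Dropping the last coordinate. -/
noncomputable def dropLast (n : ℕ) :
    EuclideanSpace ℝ (Fin (n + 1)) →L[ℝ] EuclideanSpace ℝ (Fin n) :=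
  LinearMap.toContinuousLinearMap
    { toFun := fun v => WithLp.toLp 2 fun i => v i.castSucc
      map_add' := fun _ _ => rfl
      map_smul' := fun _ _ => rfl }

theorem map_dropLast_gaussMarginal (t : ℕ → I) (n : ℕ) :
    (gaussMarginal (initSeg t (n + 1))).map (dropLast n) = gaussMarginal (initSeg t n) := by
  have h1 := posSemidef_minMatrix (initSeg t (n + 1))
  have h2 := posSemidef_minMatrix (initSeg t n)
  unfold gaussMarginal
  apply IsGaussian.ext
  · simp only [id_eq, integral_id_multivariateGaussian]
    rw [ContinuousLinearMap.integral_id_map, integral_id_multivariateGaussian, map_zero]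
    exact IsGaussian.integrable_id
  rw [← ContinuousLinearMap.toBilinForm_inj]
  refine LinearMap.BilinForm.ext_basis (EuclideanSpace.basisFun (Fin n) ℝ).toBasis fun i j => ?_
  rw [ContinuousLinearMap.toBilinForm_apply, ContinuousLinearMap.toBilinForm_apply,
    covarianceBilin_apply_eq_cov, covariance_map]
  · have (i : Fin n) : (fun u => inner ℝ ((EuclideanSpace.basisFun (Fin n) ℝ).toBasis i) u) ∘
        dropLast n = fun u => u i.castSucc := by
      ext; simp [PiLp.inner_apply]; rfl
    simp_rw [this, covariance_eval_multivariateGaussian h1,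
      covarianceBilin_multivariateGaussian h2]
    simp [minMatrix, initSeg]
  any_goals exact Measurable.aestronglyMeasurable (by fun_prop)
  · fun_prop
  · exact IsGaussian.memLp_two_id

/-- The sequence defining `φ K` decreases, so it converges to `φ K`. -/
theorem tendsto_compactContent (t : ℕ → I) {K : Set PathSpace} (hK : IsCompact K) :
    Tendsto (fun n : ℕ => cylMeasure (initSeg t n)
        (pathProj (initSeg t n) ⁻¹' (pathProj (initSeg t n) '' K)))
      atTop (𝓝 (compactContent t K)) := by
  refine tendsto_nhds_limUnder ⟨_, tendsto_atTop_iInf (antitone_nat_of_succ_le fun n => ?_)⟩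
  have h (m : ℕ) : pathProj (initSeg t m) '' (pathProj (initSeg t m) ⁻¹'
      (pathProj (initSeg t m) '' K)) = pathProj (initSeg t m) '' K :=
    Set.image_preimage_eq_of_subset (Set.image_subset_range _ _)
  simp only [cylMeasure, h]
  rw [← map_dropLast_gaussMarginal t n, Measure.map_apply (by fun_prop)
    (hK.image (continuous_pathProj _)).isClosed.measurableSet]
  refine measure_mono ?_
  rintro _ ⟨x, hx, rfl⟩
  exact ⟨x, hx, rfl⟩

/-- In particular `μ` takes values in `[0, 1]`. -/
theorem innerContent_le_one (t : ℕ → I) (A : Set PathSpace) : innerContent t A ≤ 1 := by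
  refine iSup_le fun K => iSup_le fun _ => iSup_le fun hK => ?_
  refine le_of_tendsto' (tendsto_compactContent t hK) fun n => ?_
  have : IsProbabilityMeasure (gaussMarginal (initSeg t n)) := by
    unfold gaussMarginal; infer_instance
  exact prob_le_one

/-! The function `μ` is the restriction to Borel sets of a finite measure, so it is additive. The
normal laws `ν_n` are the marginals of one measure `G` on `ℕ → ℝ`, built from independent standard
normals. Since the times are dense, `seqProj t` embeds the Polish space of paths injectively in `ℕ →
ℝ`, and `G` pulls back along it. On compact sets this pullback is `φ`; inner regularity then makes
it `μ`. Its total mass is never needed, so no continuity of Brownian paths is proved. -/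

/-- A lower triangular factorisation of the Gram matrix of a sequence of vectors. -/
theorem exists_triangular_factor_gram {E : Type*} [NormedAddCommGroup E] [InnerProductSpace ℝ E]
    (v : ℕ → E) :
    ∃ c : ℕ → ℕ → ℝ, (∀ i k, i < k → c i k = 0) ∧
      ∀ i j n, i < n → ∑ k ∈ Finset.range n, c i k * c j k = inner ℝ (v i) (v j) := by
  let u := InnerProductSpace.gramSchmidtNormed ℝ v
  have hu (j k : ℕ) (hjk : j ≠ k) : inner ℝ (u j) (u k) = 0 := by
    simp [u, InnerProductSpace.gramSchmidtNormed, inner_smul_left, inner_smul_right,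
      InnerProductSpace.gramSchmidt_orthogonal ℝ v hjk]
  -- Dependent vectors (repeated times, or time `0`) normalise to `0`, so `u k` has norm `1` or `0`.
  have hu1 (k : ℕ) : inner ℝ (u k) (u k) • u k = u k := by
    by_cases h : u k = 0
    · simp [h]
    · rw [real_inner_self_eq_norm_sq, InnerProductSpace.gramSchmidtNormed_unit_length' h]
      simp
  have expand (n : ℕ) (x : E) (hx : x ∈ Submodule.span ℝ (u '' Set.Iio n)) :
      ∑ k ∈ Finset.range n, inner ℝ (u k) x • u k = x := by
    induction hx using Submodule.span_induction with
    | mem x hx =>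
      obtain ⟨j, hj, rfl⟩ := hx
      rw [Finset.sum_eq_single_of_mem j (Finset.mem_range.2 hj) fun k _ hk => by
        rw [hu k j hk, zero_smul], hu1]
    | zero => simp
    | add x y _ _ hx hy => simp [inner_add_right, add_smul, Finset.sum_add_distrib, hx, hy]
    | smul a x _ hx => simp [inner_smul_right, mul_smul, ← Finset.smul_sum, hx]
  refine ⟨fun i k => inner ℝ (u k) (v i), fun i k hik => ?_, fun i j n hin => ?_⟩
  · simp [u, InnerProductSpace.gramSchmidtNormed, inner_smul_left,
      InnerProductSpace.gramSchmidt_inv_triangular ℝ v hik]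
  · have hv : v i ∈ Submodule.span ℝ (u '' Set.Iio n) := by
      rw [InnerProductSpace.span_gramSchmidtNormed, InnerProductSpace.span_gramSchmidt_Iio]
      exact Submodule.subset_span ⟨i, hin, rfl⟩
    conv_rhs => rw [← expand n _ hv]
    simp [sum_inner, inner_smul_left]

/-- A linear image of a standard Gaussian vector is Gaussian with covariance `C * Cᵀ`. -/
theorem map_toEuclideanCLM_stdGaussian {n : ℕ} {C S : Matrix (Fin n) (Fin n) ℝ}
    (hS : S.PosSemidef) (hC : C * C.transpose = S) :
    (stdGaussian (EuclideanSpace ℝ (Fin n))).map (Matrix.toEuclideanCLM (𝕜 := ℝ) C) =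
      multivariateGaussian 0 S := by
  apply IsGaussian.ext
  · simp only [id_eq, integral_id_multivariateGaussian]
    rw [ContinuousLinearMap.integral_id_map, integral_id_stdGaussian, map_zero]
    exact IsGaussian.integrable_id
  ext x y
  rw [covarianceBilin_map IsGaussian.memLp_two_id, covarianceBilin_stdGaussian,
    covarianceBilin_multivariateGaussian hS, innerSL_apply_apply,
    ContinuousLinearMap.adjoint_inner_left, ← ContinuousLinearMap.star_eq_adjoint, ← map_star,
    ← ContinuousLinearMap.comp_apply, ← ContinuousLinearMap.mul_def, ← map_mul,
    Matrix.inner_toEuclideanCLM, ← hC, Matrix.star_eq_conjTranspose,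
    Matrix.conjTranspose_eq_transpose_of_trivial]

/-- The first `n` terms of a sequence, as a vector. -/
noncomputable def initVec (n : ℕ) (y : ℕ → ℝ) : EuclideanSpace ℝ (Fin n) :=
  WithLp.toLp 2 fun k => y k

theorem continuous_initVec (n : ℕ) : Continuous (initVec n) :=
  (PiLp.continuous_toLp 2 _).comp (by fun_prop)

/-- The initial coordinates of a sequence of independent standard normal variables. -/
theorem map_initial_infinitePi_gaussianReal (n : ℕ) :
    (Measure.infinitePi fun _ : ℕ => gaussianReal 0 1).map (initVec n) =
      stdGaussian (EuclideanSpace ℝ (Fin n)) := by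
  have h : iIndepFun (fun (k : Fin n) (ω : ℕ → ℝ) => ω k)
      (Measure.infinitePi fun _ : ℕ => gaussianReal 0 1) :=
    (iIndepFun_infinitePi (X := fun _ x => x) (by fun_prop)).precomp Fin.val_injective
  rw [iIndepFun_iff_map_fun_eq_pi_map fun k => (measurable_pi_apply _).aemeasurable] at h
  simp only [Measure.infinitePi_map_eval] at h
  rw [← map_pi_eq_stdGaussian, ← h, Measure.map_map (by fun_prop) (by fun_prop)]
  rfl

/-- As `min s t` is the inner product of the indicators of `[0, s]` and `[0, t]`, a triangular Gram
factor serves all `n` at once. -/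
theorem exists_measure_map_initVec (t : ℕ → I) :
    ∃ G : Measure (ℕ → ℝ), ∀ n, G.map (initVec n) = gaussMarginal (initSeg t n) := by
  let v (i : ℕ) : Lp ℝ 2 (volume : Measure ℝ) :=
    indicatorConstLp 2 (measurableSet_Icc (a := (0 : ℝ)) (b := t i))
      isCompact_Icc.measure_ne_top 1
  have hv (i j : ℕ) : inner ℝ (v i) (v j) = min (t i : ℝ) (t j) := by
    have h1 : 0 ≤ (t i : ℝ) := (t i).2.1
    have h2 : 0 ≤ (t j : ℝ) := (t j).2.1
    simp [v, L2.real_inner_indicatorConstLp_one_indicatorConstLp_one, Set.Icc_inter_Icc, h1, h2]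
  obtain ⟨c, hc0, hc⟩ := exists_triangular_factor_gram v
  -- By triangularity the first `n` terms of `X ω` depend only on the first `n` terms of `ω`.
  let X (ω : ℕ → ℝ) (i : ℕ) : ℝ := ∑ k ∈ Finset.range (i + 1), c i k * ω k
  have hX : Measurable X := by fun_prop
  refine ⟨(Measure.infinitePi fun _ : ℕ => gaussianReal 0 1).map X, fun n => ?_⟩
  let C : Matrix (Fin n) (Fin n) ℝ := Matrix.of fun i k => c i k
  have hC : C * C.transpose = minMatrix (initSeg t n) := by
    ext i j
    simp only [Matrix.mul_apply, C, Matrix.transpose_apply, Matrix.of_apply, minMatrix, initSeg]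
    rw [Fin.sum_univ_eq_sum_range (fun k => c i k * c j k), hc i j n i.2, hv]
  rw [gaussMarginal, ← map_toEuclideanCLM_stdGaussian (posSemidef_minMatrix _) hC,
    ← map_initial_infinitePi_gaussianReal, Measure.map_map (continuous_initVec n).measurable hX,
    Measure.map_map (by fun_prop) (continuous_initVec n).measurable]
  congr 1
  ext ω i
  simp only [Function.comp_apply, initVec, X, Matrix.toEuclideanCLM_toLp, Matrix.mulVec,
    dotProduct, C, Matrix.of_apply]
  rw [Fin.sum_univ_eq_sum_range (fun k => c i k * ω k)]
  refine Finset.sum_subset (Finset.range_subset_range.2 i.2) fun k _ hk => ?_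
  rw [hc0 i k (by simpa using hk), zero_mul]

/-- The values of a path along the sequence of times. -/
def seqProj (t : ℕ → I) (x : PathSpace) : ℕ → ℝ := fun i => x.1 (t i)

theorem continuous_seqProj (t : ℕ → I) : Continuous (seqProj t) :=
  continuous_pi fun i => (continuous_eval_const (t i)).comp continuous_subtype_val

theorem injective_seqProj {t : ℕ → I} (ht : DenseRange t) : Function.Injective (seqProj t) :=
  fun x y h => Subtype.ext <| DFunLike.coe_injective <|
    ht.equalizer x.1.continuous y.1.continuous h

theorem initVec_seqProj (t : ℕ → I) (n : ℕ) (x : PathSpace) :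
    initVec n (seqProj t x) = pathProj (initSeg t n) x := rfl

/-- A closed set of sequences is the intersection of the cylinders over its projections. -/
theorem iInter_preimage_image_initVec {F : Set (ℕ → ℝ)} (hF : IsClosed F) :
    ⋂ n, initVec n ⁻¹' (initVec n '' F) = F := by
  refine Set.Subset.antisymm (fun y hy => ?_)
    (Set.subset_iInter fun n => Set.subset_preimage_image _ _)
  choose z hzF hz using fun n => Set.mem_iInter.1 hy n
  -- `z n` agrees with `y` in the first `n` places, so `z n` tends to `y` coordinatewise.
  refine hF.mem_of_tendsto (f := z) (b := atTop) (tendsto_pi_nhds.2 fun i => ?_)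
    (Eventually.of_forall hzF)
  refine tendsto_const_nhds.congr' ?_
  filter_upwards [eventually_gt_atTop i] with n hn
  exact congrArg (fun w : EuclideanSpace ℝ (Fin n) => w ⟨i, hn⟩) (hz n).symm

theorem antitone_preimage_image_initVec (F : Set (ℕ → ℝ)) :
    Antitone fun n => initVec n ⁻¹' (initVec n '' F) := by
  rintro m n hmn y ⟨z, hz, hzy⟩
  refine ⟨z, hz, ?_⟩
  ext i
  exact congrArg (fun w : EuclideanSpace ℝ (Fin n) => w (i.castLE hmn)) hzy

/-- The image of `K` is compact, hence closed, so the cylinders over its projections decrease to it;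
`G` is continuous from above. -/
theorem compactContent_eq_measure_image {t : ℕ → I} {G : Measure (ℕ → ℝ)} [IsFiniteMeasure G]
    (hG : ∀ n, G.map (initVec n) = gaussMarginal (initSeg t n))
    {K : Set PathSpace} (hK : IsCompact K) :
    compactContent t K = G (seqProj t '' K) := by
  have hF := hK.image (continuous_seqProj t)
  have hmeas (n : ℕ) : MeasurableSet (initVec n '' (seqProj t '' K)) :=
    (hF.image (continuous_initVec n)).isClosed.measurableSet
  have hlim := tendsto_measure_iInter_atTop (μ := G)
    (fun n => (((continuous_initVec n).measurable (hmeas n))).nullMeasurableSet)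
    (antitone_preimage_image_initVec (seqProj t '' K)) ⟨0, measure_ne_top _ _⟩
  rw [iInter_preimage_image_initVec hF.isClosed] at hlim
  refine tendsto_nhds_unique (tendsto_compactContent t hK) (hlim.congr fun n => ?_)
  rw [cylMeasure, Set.image_preimage_eq_of_subset (Set.image_subset_range _ _), ← hG,
    Function.comp_apply, ← Measure.map_apply (continuous_initVec n).measurable (hmeas n),
    Set.image_image]
  rfl

instance polishSpace_pathSpace : PolishSpace PathSpace :=
  (isClosed_eq (continuous_eval_const (0 : I)) continuous_const :
    IsClosed {x : C(I, ℝ) | x 0 = 0}).polishSpace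

/-- The set function `μ` is a finite Borel measure. -/
theorem exists_measure_eq_innerContent {t : ℕ → I} (ht : DenseRange t) :
    ∃ ρ : @Measure PathSpace pathBorel,
      ∀ A, MeasurableSet[pathBorel] A → ρ A = innerContent t A := by
  let _ : MeasurableSpace PathSpace := pathBorel
  have : BorelSpace PathSpace := ⟨rfl⟩
  obtain ⟨G, hG⟩ := exists_measure_map_initVec t
  have : IsFiniteMeasure G := by
    have : IsFiniteMeasure (G.map (initVec 0)) := by
      rw [hG, gaussMarginal]; infer_instance
    exact Measure.isFiniteMeasure_of_map (continuous_initVec 0).measurable.aemeasurable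
  -- Lusin–Souslin: a continuous injection of a Polish space maps Borel sets to Borel sets.
  have hemb := (continuous_seqProj t).measurableEmbedding (injective_seqProj ht)
  have : IsFiniteMeasure (G.comap (seqProj t)) :=
    ⟨by rw [hemb.comap_apply]; exact measure_lt_top _ _⟩
  refine ⟨G.comap (seqProj t), fun A hA => ?_⟩
  -- Finite Borel measures on a Polish space are inner regular for compact sets.
  rw [hA.measure_eq_iSup_isCompact_of_ne_top (measure_ne_top _ _), innerContent]
  refine iSup_congr fun K => iSup_congr fun _ => iSup_congr fun hK => ?_
  rw [hemb.comap_apply, compactContent_eq_measure_image hG hK]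

theorem lemma3 (t : ℕ → I) (ht : DenseRange t) (A B : Set PathSpace)
    (hA : MeasurableSet[pathBorel] A) (hB : MeasurableSet[pathBorel] B) (hAB : A ∩ B = ∅) :
    innerContent t (A ∪ B) = innerContent t A + innerContent t B := by
  let _ : MeasurableSpace PathSpace := pathBorel
  obtain ⟨ρ, hρ⟩ := exists_measure_eq_innerContent ht
  rw [← hρ _ (hA.union hB), ← hρ A hA, ← hρ B hB,
    measure_union (Set.disjoint_iff_inter_eq_empty.2 hAB) hB]
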